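/- Let $A$ be a unital C*-algebra and let $l_2(A)$ be the left Hilbert $A$-module of all sequences $a=(a_i)_{i\in\mathbb N}$ in $A$ for which $\sum_i a_i a_i^*$ converges in norm, with $A$-valued inner product $\langle a,b\rangle=\sum_i a_i b_i^*$ and norm $\|a\|=\|\langle a,a\rangle\|^{1/2}$. Let $\mathbb J$ be a finite or countable index set. For a family $\{x_j\}_{j\in\mathbb J}$ in $l_2(A)$ we use the following terms. - It is a *standard frame* if for every $x\in l_2(A)$ the sum $\sum_j\langle x,x_j\rangle\langle x_j,x\rangle$ converges in norm and there are real constants $C,D>0$ with $C\langle x,x\rangle\le\sum_j\langle x,x_j\rangle\langle x_j,x\rangle\le D\langle x,x\rangle$ for all $x\in l_2(A)$. - It is *generating* if its finite $A$-linear combinations are norm-dense in $l_2(A)$. - It is an *orthonormal basis* if it is generating, $\langle x_j,x_j\rangle=1_A$ for all $j$, and $\langle x_i,x_j\rangle=0$ for $i\ne j$. - It is a *standard Riesz basis* if it is a generating standard frame and, for every $S\subseteq\mathbb J$ and all $a_j\in A$ ($j\in S$), the sum $\sum_{j\in S}a_jx_j$ converges (unconditionally in norm) to $0$ if and only if $a_jx_j=0$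 for every $j\in S$. **Theorem.** For every standard frame $\{f_j\}_{j\in\mathbb J}$ of $l_2(A)$ there are a scalar $c\in\mathbb C$, an orthonormal basis $\{e_j\}_{j\in\mathbb J}$ of $l_2(A)$ and a standard Riesz basis $\{r_j\}_{j\in\mathbb J}$ of $l_2(A)$ such that $f_j=c\,(e_j+r_j)$ for every $j\in\mathbb J$. -/

import Mathlib

open scoped InnerProductSpace

section Algebra

variable {A : Type*} [CStarAlgebra A] [PartialOrder A] [StarOrderedRing A]

theorem summable_of_nonneg_of_le_cstar {ι : Type*} {f g : ι → A} (hf : ∀ i, 0 ≤ f i)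
    (hfg : ∀ i, f i ≤ g i) (hg : Summable g) : Summable f := by
  rw [summable_iff_vanishing_norm] at hg ⊢
  intro ε hε
  obtain ⟨s, hs⟩ := hg ε hε
  refine ⟨s, fun t ht => lt_of_le_of_lt ?_ (hs t ht)⟩
  exact CStarAlgebra.norm_le_norm_of_nonneg_of_le (Finset.sum_nonneg fun i _ => hf i)
    (Finset.sum_le_sum fun i _ => hfg i)

theorem summable_add_mul_star {ι : Type*} {x y : ι → A}
    (hx : Summable fun j => x j * star (x j)) (hy : Summable fun j => y j * star (y j)) :
    Summable fun j => (x j + y j) * star (x j + y j) := by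
  refine summable_of_nonneg_of_le_cstar (fun j => mul_star_self_nonneg _) (fun j => ?_)
    ((hx.add hx).add (hy.add hy))
  have h : 0 ≤ (x j - y j) * star (x j - y j) := mul_star_self_nonneg _
  rw [← sub_nonneg]
  convert h using 1
  simp only [star_add, star_sub]
  noncomm_ring

end Algebra

/-- The sequences `x : ℕ → A` for which `∑ j, x j * (x j)⋆` converges in norm, as a left
`A`-submodule of all sequences. (All terms are positive, so ordered and unordered convergence
agree.) -/
def l2Submodule (A : Type*) [CStarAlgebra A] [PartialOrder A] [StarOrderedRing A] :
    Submodule A (ℕ → A) where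
  carrier := {x | Summable fun j => x j * star (x j)}
  add_mem' hx hy := summable_add_mul_star hx hy
  zero_mem' := by simp
  smul_mem' a x hx := by
    have h : Summable fun j => a * (x j * star (x j)) * star a :=
      (Summable.mul_left a hx).mul_right (star a)
    simpa [mul_assoc] using h

/-- The standard Hilbert `A`-module `ℓ₂(A)`. -/
def L2 (A : Type*) [CStarAlgebra A] [PartialOrder A] [StarOrderedRing A] : Type _ :=
  l2Submodule A

namespace L2

variable {A : Type*} [CStarAlgebra A] [PartialOrder A] [StarOrderedRing A]

instance : AddCommGroup (L2 A) := inferInstanceAs (AddCommGroup (l2Submodule A))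

instance : Module A (L2 A) := inferInstanceAs (Module A (l2Submodule A))

noncomputable instance : Module ℂ (L2 A) := inferInstanceAs (Module ℂ (l2Submodule A))

/-- The underlying sequence of an element of `ℓ₂(A)`. -/
def coord (x : L2 A) : ℕ → A := Subtype.val (p := fun y => y ∈ l2Submodule A) x

instance : CoeFun (L2 A) (fun _ => ℕ → A) := ⟨coord⟩

/-- The element of `ℓ₂(A)` with a given square-summable sequence of coordinates. -/
def mk (x : ℕ → A) (hx : Summable fun j => x j * star (x j)) : L2 A :=
  (⟨x, hx⟩ : l2Submodule A)

@[simp] theorem mk_apply (x : ℕ → A) (hx : Summable fun j => x j * star (x j)) (j : ℕ) :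
    mk x hx j = x j := rfl

@[ext] theorem ext {x y : L2 A} (h : ∀ j, x j = y j) : x = y := Subtype.ext (funext h)

@[simp] theorem add_apply (x y : L2 A) (j : ℕ) : (x + y) j = x j + y j := rfl

@[simp] theorem zero_apply (j : ℕ) : (0 : L2 A) j = 0 := rfl

@[simp] theorem smul_apply (a : A) (x : L2 A) (j : ℕ) : (a • x) j = a * x j := rfl

@[simp] theorem complex_smul_apply (c : ℂ) (x : L2 A) (j : ℕ) : (c • x) j = c • x j := rfl

theorem summable_self (x : L2 A) : Summable fun j => x j * star (x j) := x.2

theorem summable_inner (x y : L2 A) : Summable fun j => y j * star (x j) := by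
  have h1 := (x + y).summable_self
  have h2 := (y + Complex.I • x).summable_self
  have hx := x.summable_self
  have hy := y.summable_self
  have h := ((h1.sub hx).sub hy).add
    (((h2.sub hx).sub hy).const_smul Complex.I)
  have h' := h.const_smul (1 / 2 : ℂ)
  refine h'.congr fun j => ?_
  simp only [add_apply, complex_smul_apply, star_add, star_smul, add_mul, mul_add,
    smul_mul_assoc, mul_smul_comm, smul_smul, smul_sub, smul_add, Complex.star_def,
    Complex.conj_I]
  simp only [← mul_assoc, mul_neg, neg_mul, Complex.I_mul_I]
  module

/-- The `A`-valued inner product, in Mathlib's convention for left modules over `A`: it is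
`A`-linear in the second argument, so the textbook `⟨x, y⟩ = ∑ j, x j * (y j)⋆`, linear in the
first argument, is `⟪y, x⟫_A`. -/
noncomputable instance : Inner A (L2 A) := ⟨fun x y => ∑' j, y j * star (x j)⟩

theorem inner_def (x y : L2 A) : ⟪x, y⟫_A = ∑' j, y j * star (x j) := rfl

noncomputable instance : Norm (L2 A) := ⟨fun x => √‖⟪x, x⟫_A‖⟩

noncomputable instance : CStarModule A (L2 A) where
  inner_add_right {x y z} := by
    simp only [inner_def, add_apply, add_mul]
    exact (summable_inner x y).tsum_add (summable_inner x z)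
  inner_self_nonneg {x} := tsum_nonneg fun j => mul_star_self_nonneg (x j)
  inner_self {x} := by
    refine ⟨fun h => ?_, fun h => by simp [inner_def, h]⟩
    ext j
    have h1 : x j * star (x j) ≤ 0 := by
      rw [← h]
      exact x.summable_self.le_tsum j fun i _ => mul_star_self_nonneg (x i)
    exact (CStarRing.mul_star_self_eq_zero_iff _).1 (le_antisymm h1 (mul_star_self_nonneg (x j)))
  inner_op_smul_right {a x y} := by
    simp only [inner_def, smul_apply, mul_assoc]
    exact (summable_inner x y).tsum_mul_left a
  inner_smul_right_complex {c x y} := by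
    simp only [inner_def, complex_smul_apply, smul_mul_assoc]
    exact (summable_inner x y).tsum_const_smul c
  star_inner x y := by
    simp only [inner_def]
    rw [tsum_star]
    simp
  norm_eq_sqrt_norm_inner_self x := rfl

noncomputable instance : NormedAddCommGroup (L2 A) :=
  NormedAddCommGroup.ofCore (CStarModule.normedSpaceCore A)

noncomputable instance : NormedSpace ℂ (L2 A) :=
  NormedSpace.ofCore (CStarModule.normedSpaceCore A)

end L2

section Frames

variable (A : Type*) [CStarAlgebra A] [PartialOrder A] [StarOrderedRing A]
  {E : Type*} [NormedAddCommGroup E] [Module A E] [Module ℂ E] [CStarModule A E]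
  {J : Type*}

/-- Standard frames: `∑ j, ⟨x, x_j⟩ ⟨x_j, x⟩` converges in norm for all `x`, and lies between
`C ⟨x, x⟩` and `D ⟨x, x⟩` for constants `C, D > 0` independent of `x`. (In Mathlib's convention
the textbook `⟨x, y⟩` is `⟪y, x⟫_A`.) -/
def IsStandardFrame (f : J → E) : Prop :=
  (∀ x : E, Summable fun j => ⟪f j, x⟫_A * ⟪x, f j⟫_A) ∧
    ∃ C D : ℝ, 0 < C ∧ 0 < D ∧ ∀ x : E,
      C • ⟪x, x⟫_A ≤ ∑' j, ⟪f j, x⟫_A * ⟪x, f j⟫_A ∧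
      ∑' j, ⟪f j, x⟫_A * ⟪x, f j⟫_A ≤ D • ⟪x, x⟫_A

/-- The finite `A`-linear combinations of the family are norm-dense. -/
def IsGenerating (f : J → E) : Prop :=
  Dense (Submodule.span A (Set.range f) : Set E)

/-- Standard Riesz bases: generating standard frames such that a norm-convergent `A`-linear
combination over a (possibly infinite) set of indices vanishes only if each summand does. -/
def IsStandardRieszBasis (f : J → E) : Prop :=
  IsStandardFrame A f ∧ IsGenerating A f ∧
    ∀ (S : Set J) (a : S → A), HasSum (fun j : S => a j • f j) 0 ↔ ∀ j : S, a j • f j = 0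

/-- Orthonormal bases: generating families with `⟨e_i, e_j⟩ = δ_{ij} 1_A`. -/
def IsOrthonormalBasis (e : J → E) : Prop :=
  (∀ j, ⟪e j, e j⟫_A = 1) ∧ (∀ i j, i ≠ j → ⟪e i, e j⟫_A = 0) ∧ IsGenerating A e

end Frames

/-! Let `D` be an upper frame bound and let `ε j` be the standard basis, reindexed by a bijection of
`J` with `ℕ`. The analysis map `x ↦ (⟪f j, x⟫_A)` has norm at most `√D`, hence by duality so does
synthesis `ε j ↦ f j` (`norm_sum_smul_le`). For `t = 1 / (2√D)` the map `ε j ↦ ε j + t f j` is then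
within `1 / 2` of the identity, so it should carry the orthonormal basis to a Riesz basis `r`.
Taking `e j = -ε j` leaves `e j + r j = t f j`, whence `c = 1 / t`. No operator is inverted: the
frame bounds, density and independence each follow from estimates on analysis or on finite sums. The
bijection exists because the lower frame bound forces `J` to be infinite when `A ≠ 0`
(`infinite_of_isStandardFrame`). -/

namespace CStarModule

variable {A : Type*} [CStarAlgebra A] [PartialOrder A] [StarOrderedRing A]
  {E : Type*} [NormedAddCommGroup E] [Module A E] [Module ℂ E] [CStarModule A E]

/-- By the parallelogram identity, the difference of the two sides is `⟪x - y, x - y⟫_A`. This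
replaces the triangle inequality, as frame bounds are inequalities in `A`, not between norms. -/
theorem inner_self_add_le (x y : E) :
    ⟪x + y, x + y⟫_A ≤ (2 : ℝ) • (⟪x, x⟫_A + ⟪y, y⟫_A) := by
  have h : 0 ≤ ⟪x - y, x - y⟫_A := inner_self_nonneg
  rw [← sub_nonneg]
  convert h using 1
  simp only [inner_add_left, inner_add_right, inner_sub_left, inner_sub_right]
  module

theorem inner_self_sub_le (x y : E) :
    ⟪x - y, x - y⟫_A ≤ (2 : ℝ) • (⟪x, x⟫_A + ⟪y, y⟫_A) := by
  have h : 0 ≤ ⟪x + y, x + y⟫_A := inner_self_nonneg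
  rw [← sub_nonneg]
  convert h using 1
  simp only [inner_add_left, inner_add_right, inner_sub_left, inner_sub_right]
  module

end CStarModule

open CStarModule Filter Topology

/-! ### Coordinates and the standard basis of `ℓ₂(A)` -/

namespace L2

variable {A : Type*} [CStarAlgebra A] [PartialOrder A] [StarOrderedRing A] {J : Type*}

theorem inner_conj (x y : L2 A) : ⟪x, y⟫_A = star ⟪y, x⟫_A :=
  (CStarModule.star_inner (A := A) (E := L2 A) y x).symm

theorem inner_smul_right (a : A) (x y : L2 A) : ⟪x, a • y⟫_A = a * ⟪x, y⟫_A :=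
  CStarModule.inner_op_smul_right (A := A) (E := L2 A)

theorem inner_sum_right {ι : Type*} (s : Finset ι) (x : L2 A) (y : ι → L2 A) :
    ⟪x, ∑ i ∈ s, y i⟫_A = ∑ i ∈ s, ⟪x, y i⟫_A :=
  CStarModule.inner_sum_right (A := A) (E := L2 A)

theorem inner_complex_smul_left (c : ℂ) (x y : L2 A) : ⟪c • x, y⟫_A = star c • ⟪x, y⟫_A :=
  CStarModule.inner_smul_left_complex (A := A) (E := L2 A)

theorem inner_complex_smul_right (c : ℂ) (x y : L2 A) : ⟪x, c • y⟫_A = c • ⟪x, y⟫_A :=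
  CStarModule.inner_smul_right_complex (A := A) (E := L2 A)

@[simp] theorem sub_apply (x y : L2 A) (n : ℕ) : (x - y) n = x n - y n := rfl

@[simp] theorem sum_apply {ι : Type*} (s : Finset ι) (x : ι → L2 A) (n : ℕ) :
    (∑ i ∈ s, x i) n = ∑ i ∈ s, x i n := by
  classical
  induction s using Finset.induction_on with
  | empty => simp
  | insert i s hi ih => simp [Finset.sum_insert hi, ih]

/-- The standard basis vectors of `ℓ₂(A)`. -/
def stdBasis (A : Type*) [CStarAlgebra A] [PartialOrder A] [StarOrderedRing A] (n : ℕ) : L2 A :=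
  mk (Pi.single n 1) <| summable_of_ne_finset_zero (s := {n}) fun m hm => by
    simp [Pi.single_eq_of_ne (Finset.notMem_singleton.1 hm)]

theorem stdBasis_apply (m n : ℕ) : stdBasis A m n = if n = m then 1 else 0 := by
  simp [stdBasis, Pi.single_apply]

theorem inner_stdBasis_left (n : ℕ) (x : L2 A) : ⟪stdBasis A n, x⟫_A = x n := by
  rw [inner_def, tsum_eq_single n]
  · simp [stdBasis_apply]
  · intro m hm
    simp [stdBasis_apply, hm]

theorem inner_stdBasis_right (n : ℕ) (x : L2 A) : ⟪x, stdBasis A n⟫_A = star (x n) := by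
  rw [← inner_stdBasis_left, inner_conj]

theorem inner_stdBasis_stdBasis (m n : ℕ) :
    ⟪stdBasis A m, stdBasis A n⟫_A = if m = n then 1 else 0 := by
  rw [inner_stdBasis_left, stdBasis_apply]

theorem norm_stdBasis_le (n : ℕ) : ‖stdBasis A n‖ ≤ 1 := by
  have h := norm_sq_eq A (x := stdBasis A n)
  rw [inner_stdBasis_stdBasis, if_pos rfl] at h
  rcases subsingleton_or_nontrivial A with hA | hA
  · rw [Subsingleton.elim (1 : A) 0, norm_zero] at h
    nlinarith [norm_nonneg (stdBasis A n)]
  · rw [CStarRing.norm_one] at h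
    nlinarith [norm_nonneg (stdBasis A n)]

theorem norm_apply_le (x : L2 A) (n : ℕ) : ‖x n‖ ≤ ‖x‖ := by
  rw [← inner_stdBasis_left n x]
  exact (norm_inner_le (L2 A)).trans
    (mul_le_of_le_one_left (norm_nonneg x) (norm_stdBasis_le n))

theorem hasSum_stdBasis (x : L2 A) : HasSum (fun n => x n • stdBasis A n) x := by
  classical
  -- The squared error of a partial sum is the norm of the tail of the convergent series `⟪x, x⟫_A`.
  have key (F : Finset ℕ) : ‖∑ n ∈ F, x n • stdBasis A n - x‖ =
      √‖∑' n : {n // n ∉ F}, x n * star (x n)‖ := by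
    rw [norm_eq_sqrt_norm_inner_self (A := A), inner_def]
    congr 2
    refine Eq.trans ?_ (tsum_subtype {n | n ∉ F} fun n => x n * star (x n)).symm
    refine tsum_congr fun n => ?_
    by_cases hn : n ∈ F <;> simp [stdBasis_apply, Set.indicator, hn]
  rw [HasSum, SummationFilter.unconditional_filter, tendsto_iff_norm_sub_tendsto_zero]
  simp_rw [key]
  have h := (tendsto_tsum_compl_atTop_zero fun n => x n * star (x n)).norm.sqrt
  simpa using h

/-- The sign makes `e j` cancel the standard vector contained in `r j`. -/
theorem isOrthonormalBasis_neg_stdBasis (σ : J ≃ ℕ) :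
    IsOrthonormalBasis A fun j => -stdBasis A (σ j) := by
  refine ⟨fun j => ?_, fun i j hij => ?_, fun x => ?_⟩
  · simp [inner_stdBasis_stdBasis]
  · simp [inner_stdBasis_stdBasis, hij]
  · refine mem_closure_of_tendsto (hasSum_stdBasis x) (Eventually.of_forall fun F => ?_)
    refine Submodule.sum_mem _ fun n _ => Submodule.smul_mem _ _ ?_
    rw [← neg_mem_iff]
    exact Submodule.subset_span ⟨σ.symm n, by simp⟩

/-! ### Perturbing the standard basis by a multiple of the frame -/

section Perturbation

variable {f : J → L2 A} {D : ℝ}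

/-- The sequence of frame coefficients of a vector, indexed by `ℕ`. -/
noncomputable def analysis (f : J → L2 A) (σ : J ≃ ℕ)
    (hs : ∀ x : L2 A, Summable fun j => ⟪f j, x⟫_A * ⟪x, f j⟫_A) (x : L2 A) : L2 A :=
  mk (fun n => ⟪f (σ.symm n), x⟫_A) <| by
    simpa only [Function.comp_def, ← inner_conj] using σ.symm.summable_iff.2 (hs x)

variable (σ : J ≃ ℕ) (hs : ∀ x : L2 A, Summable fun j => ⟪f j, x⟫_A * ⟪x, f j⟫_A)

theorem analysis_apply (x : L2 A) (j : J) : analysis f σ hs x (σ j) = ⟪f j, x⟫_A := by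
  simp [analysis]

theorem inner_analysis_self (x : L2 A) :
    ⟪analysis f σ hs x, analysis f σ hs x⟫_A = ∑' j, ⟪f j, x⟫_A * ⟪x, f j⟫_A := by
  rw [inner_def, ← σ.tsum_eq]
  simp_rw [analysis_apply, ← inner_conj]

theorem norm_analysis_le (hD : 0 ≤ D)
    (hb : ∀ x : L2 A, ∑' j, ⟪f j, x⟫_A * ⟪x, f j⟫_A ≤ D • ⟪x, x⟫_A) (x : L2 A) :
    ‖analysis f σ hs x‖ ≤ √D * ‖x‖ := by
  refine le_of_sq_le_sq ?_ (by positivity)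
  rw [mul_pow, Real.sq_sqrt hD, norm_sq_eq A,
    norm_sq_eq A (x := x)]
  refine (CStarAlgebra.norm_le_norm_of_nonneg_of_le (CStarModule.inner_self_nonneg (A := A) (E := L2 A))
    ((inner_analysis_self σ hs x).trans_le (hb x))).trans ?_
  rw [norm_smul, Real.norm_of_nonneg hD]

include σ hs in
-- Synthesis is adjoint to analysis: `⟪z, z⟫_A` equals the pairing of the analysis of `z` with `b`.
-- Cauchy–Schwarz bounds it by `√D * ‖z‖ * ‖b‖`, and one factor `‖z‖` cancels.
theorem norm_sum_smul_le (hD : 0 ≤ D)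
    (hb : ∀ x : L2 A, ∑' j, ⟪f j, x⟫_A * ⟪x, f j⟫_A ≤ D • ⟪x, x⟫_A) (F : Finset J) (a : J → A) :
    ‖∑ j ∈ F, a j • f j‖ ≤ √D * ‖∑ j ∈ F, a j • stdBasis A (σ j)‖ := by
  set z := ∑ j ∈ F, a j • f j with hz
  set b := ∑ j ∈ F, a j • stdBasis A (σ j) with hb'
  have h : ⟪z, z⟫_A = ⟪analysis f σ hs z, b⟫_A := by
    rw [hb', inner_sum_right]
    conv_lhs => rw [hz]
    rw [inner_sum_right]
    refine Finset.sum_congr rfl fun j _ => ?_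
    rw [inner_smul_right, inner_smul_right, inner_stdBasis_right, analysis_apply, ← inner_conj]
  have h1 : ‖z‖ ^ 2 ≤ (√D * ‖z‖) * ‖b‖ := by
    rw [norm_sq_eq A, h]
    refine (norm_inner_le (L2 A)).trans ?_
    gcongr
    exact norm_analysis_le σ hs hD hb z
  rcases (norm_nonneg z).eq_or_lt with h0 | h0
  · rw [← h0]; positivity
  · refine le_of_mul_le_mul_left ?_ h0
    linarith

include hs in
/-- A sufficiently small perturbation of the standard basis by a frame is again a frame. -/
theorem isStandardFrame_perturbation
    (hb : ∀ x : L2 A, ∑' j, ⟪f j, x⟫_A * ⟪x, f j⟫_A ≤ D • ⟪x, x⟫_A)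
    {t : ℝ} (ht : t ^ 2 * D = 1 / 4) :
    IsStandardFrame A fun j => stdBasis A (σ j) + (t : ℂ) • f j := by
  set u := analysis f σ hs with hu
  -- The frame coefficients of `x` for the perturbed family are the coordinates of `x + t u x`, so
  -- the frame sum is its inner square.
  have hcoef (x : L2 A) (j : J) :
      ⟪stdBasis A (σ j) + (t : ℂ) • f j, x⟫_A = (x + (t : ℂ) • u x) (σ j) := by
    have h : ⟪stdBasis A (σ j) + (t : ℂ) • f j, x⟫_A =
        ⟪stdBasis A (σ j), x⟫_A + star (t : ℂ) • ⟪f j, x⟫_A := by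
      rw [CStarModule.inner_add_left (A := A) (E := L2 A), inner_complex_smul_left]
    rw [h, inner_stdBasis_left, add_apply, complex_smul_apply, hu, analysis_apply]
    simp
  have hterm (x : L2 A) : (fun j => ⟪stdBasis A (σ j) + (t : ℂ) • f j, x⟫_A *
      ⟪x, stdBasis A (σ j) + (t : ℂ) • f j⟫_A) =
      (fun n => (x + (t : ℂ) • u x) n * star ((x + (t : ℂ) • u x) n)) ∘ σ := by
    funext j
    rw [inner_conj x, hcoef, Function.comp_apply]
  have hsum (x : L2 A) : ∑' j, ⟪stdBasis A (σ j) + (t : ℂ) • f j, x⟫_A *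
      ⟪x, stdBasis A (σ j) + (t : ℂ) • f j⟫_A =
      ⟪x + (t : ℂ) • u x, x + (t : ℂ) • u x⟫_A := by
    rw [hterm, inner_def]
    exact σ.tsum_eq fun n => (x + (t : ℂ) • u x) n * star ((x + (t : ℂ) • u x) n)
  have hpert (x : L2 A) : ⟪(t : ℂ) • u x, (t : ℂ) • u x⟫_A ≤ (1 / 4 : ℝ) • ⟪x, x⟫_A := by
    have h : ⟪(t : ℂ) • u x, (t : ℂ) • u x⟫_A = t ^ 2 • ⟪u x, u x⟫_A := by
      rw [inner_complex_smul_left, inner_complex_smul_right, smul_smul,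
        pow_two, ← Complex.coe_smul]
      simp
    rw [h, inner_analysis_self, ← ht, mul_smul]
    exact smul_le_smul_of_nonneg_left (hb x) (sq_nonneg t)
  -- With `y = x + t u x`: `⟪y, y⟫_A ≤ 2 (1 + 1/4) ⟪x, x⟫_A` gives `5 / 2`, while `⟪x, x⟫_A ≤ 2 (⟪y,
  -- y⟫_A + 1/4 ⟪x, x⟫_A)` gives `1 / 4`.
  refine ⟨fun x => ?_, 1 / 4, 5 / 2, by norm_num, by norm_num, fun x => ?_⟩
  · rw [hterm]
    exact σ.summable_iff.2 (x + (t : ℂ) • u x).summable_self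
  · rw [hsum]
    constructor
    · have h := inner_self_sub_le (A := A) (x + (t : ℂ) • u x) ((t : ℂ) • u x)
      rw [add_sub_cancel_right] at h
      have h1 := h.trans (smul_le_smul_of_nonneg_left (add_le_add_right (hpert x) _)
        (zero_le_two (α := ℝ)))
      rw [← sub_nonneg] at h1 ⊢
      have h2 := smul_nonneg (one_half_pos (α := ℝ)).le h1
      convert h2 using 1
      module
    · refine (inner_self_add_le (A := A) x ((t : ℂ) • u x)).trans
        ((smul_le_smul_of_nonneg_left (add_le_add_right (hpert x) _)
          (zero_le_two (α := ℝ))).trans_eq ?_)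
      module

include hs in
theorem norm_sum_smul_perturbation_le (hD : 0 < D)
    (hb : ∀ x : L2 A, ∑' j, ⟪f j, x⟫_A * ⟪x, f j⟫_A ≤ D • ⟪x, x⟫_A) {t : ℝ} (ht0 : 0 ≤ t)
    (ht : t * √D = 1 / 2) (F : Finset J) (a : J → A) :
    ‖∑ j ∈ F, a j • (stdBasis A (σ j) + (t : ℂ) • f j) - ∑ j ∈ F, a j • stdBasis A (σ j)‖ ≤
      1 / 2 * ‖∑ j ∈ F, a j • stdBasis A (σ j)‖ := by
  have h : ∑ j ∈ F, a j • (stdBasis A (σ j) + (t : ℂ) • f j) - ∑ j ∈ F, a j • stdBasis A (σ j) =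
      (t : ℂ) • ∑ j ∈ F, a j • f j := by
    ext n
    simp only [sub_apply, sum_apply, smul_apply, add_apply, complex_smul_apply, mul_add,
      Finset.sum_add_distrib, add_sub_cancel_left, Finset.smul_sum, mul_smul_comm]
  rw [h, norm_smul, Complex.norm_real, Real.norm_of_nonneg ht0, ← ht, mul_assoc]
  gcongr
  exact norm_sum_smul_le σ hs hD.le hb F a

include hs in
theorem isGenerating_perturbation (hD : 0 < D)
    (hb : ∀ x : L2 A, ∑' j, ⟪f j, x⟫_A * ⟪x, f j⟫_A ≤ D • ⟪x, x⟫_A) {t : ℝ} (ht0 : 0 ≤ t)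
    (ht : t * √D = 1 / 2) : IsGenerating A fun j => stdBasis A (σ j) + (t : ℂ) • f j := by
  set M := Submodule.span A (Set.range fun j => stdBasis A (σ j) + (t : ℂ) • f j) with hM
  -- Truncation costs `1/8` of `‖x‖` and perturbation at most half of `‖y‖ ≤ 9/8 * ‖x‖`, in total
  -- `11/16 < 3/4`. Applying this repeatedly to the remainder gives density.
  have approx (x : L2 A) : ∃ m ∈ M, ‖x - m‖ ≤ 3 / 4 * ‖x‖ := by
    rcases eq_or_ne x 0 with rfl | hx
    · exact ⟨0, M.zero_mem, by simp⟩
    have hx' : 0 < ‖x‖ := norm_pos_iff.2 hx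
    have hsum : HasSum (fun j => x (σ j) • stdBasis A (σ j)) x :=
      σ.hasSum_iff.2 (hasSum_stdBasis x)
    obtain ⟨F, hF⟩ := (Metric.tendsto_nhds.1 hsum (‖x‖ / 8) (by positivity)).exists
    rw [dist_eq_norm] at hF
    set y := ∑ j ∈ F, x (σ j) • stdBasis A (σ j) with hy
    refine ⟨∑ j ∈ F, x (σ j) • (stdBasis A (σ j) + (t : ℂ) • f j), M.sum_mem fun j _ =>
      M.smul_mem _ (Submodule.subset_span ⟨j, rfl⟩), ?_⟩
    have h1 := norm_sum_smul_perturbation_le σ hs hD hb ht0 ht F fun j => x (σ j)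
    rw [← hy] at h1
    set m := ∑ j ∈ F, x (σ j) • (stdBasis A (σ j) + (t : ℂ) • f j)
    have h2 : ‖y‖ ≤ ‖y - x‖ + ‖x‖ := norm_le_norm_sub_add y x
    have h3 : ‖x - m‖ ≤ ‖x - y‖ + ‖y - m‖ := norm_sub_le_norm_sub_add_norm_sub x y m
    rw [norm_sub_rev x y, norm_sub_rev y m] at h3
    linarith
  have iter (x : L2 A) (k : ℕ) : ∃ m ∈ M, ‖x - m‖ ≤ (3 / 4) ^ k * ‖x‖ := by
    induction k with
    | zero => exact ⟨0, M.zero_mem, by simp⟩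
    | succ k ih =>
      obtain ⟨m, hm, hxm⟩ := ih
      obtain ⟨m', hm', hxm'⟩ := approx (x - m)
      refine ⟨m + m', M.add_mem hm hm', ?_⟩
      rw [← sub_sub, pow_succ]
      linarith
  intro x
  rw [Metric.mem_closure_iff]
  intro ε hε
  have hlim : Tendsto (fun k : ℕ => (3 / 4 : ℝ) ^ k * ‖x‖) atTop (𝓝 0) := by
    simpa using (tendsto_pow_atTop_nhds_zero_of_lt_one (by norm_num : (0 : ℝ) ≤ 3 / 4)
      (by norm_num)).mul_const ‖x‖
  obtain ⟨k, hk⟩ := (hlim.eventually_lt_const hε).exists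
  obtain ⟨m, hm, hxm⟩ := iter x k
  exact ⟨m, hm, by rw [dist_eq_norm]; exact hxm.trans_lt hk⟩

include hs in
-- A perturbation of relative size `1 / 2` can at most halve the norm of the standard combination,
-- which dominates each coordinate.
theorem norm_le_two_mul_norm_sum_smul_perturbation (hD : 0 < D)
    (hb : ∀ x : L2 A, ∑' j, ⟪f j, x⟫_A * ⟪x, f j⟫_A ≤ D • ⟪x, x⟫_A) {t : ℝ} (ht0 : 0 ≤ t)
    (ht : t * √D = 1 / 2) (F : Finset J) (a : J → A) {i : J} (hi : i ∈ F) :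
    ‖a i‖ ≤ 2 * ‖∑ j ∈ F, a j • (stdBasis A (σ j) + (t : ℂ) • f j)‖ := by
  have h1 := norm_sum_smul_perturbation_le σ hs hD hb ht0 ht F a
  have h2 : ‖a i‖ ≤ ‖∑ j ∈ F, a j • stdBasis A (σ j)‖ := by
    classical
    convert norm_apply_le (∑ j ∈ F, a j • stdBasis A (σ j)) (σ i) using 2
    simp [stdBasis_apply, hi, σ.injective.eq_iff]
  have h3 := norm_le_norm_add_norm_sub
    (∑ j ∈ F, a j • (stdBasis A (σ j) + (t : ℂ) • f j)) (∑ j ∈ F, a j • stdBasis A (σ j))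
  linarith

include hs in
theorem eq_zero_of_hasSum_perturbation (hD : 0 < D)
    (hb : ∀ x : L2 A, ∑' j, ⟪f j, x⟫_A * ⟪x, f j⟫_A ≤ D • ⟪x, x⟫_A) {t : ℝ} (ht0 : 0 ≤ t)
    (ht : t * √D = 1 / 2) {S : Set J} {a : S → A}
    (ha : HasSum (fun j : S => a j • (stdBasis A (σ j) + (t : ℂ) • f j)) 0) (i : S) : a i = 0 := by
  classical
  have hlim := (ha.norm.const_mul 2)
  rw [norm_zero, mul_zero] at hlim
  refine norm_le_zero_iff.1 (ge_of_tendsto hlim ?_)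
  -- Every partial sum containing `i` bounds `‖a i‖`, and these sums tend to `0`.
  filter_upwards [eventually_ge_atTop {i}] with F hF
  have hi : i ∈ F := hF (Finset.mem_singleton_self i)
  have h := norm_le_two_mul_norm_sum_smul_perturbation σ hs hD hb ht0 ht
    (F.map (Function.Embedding.subtype _)) (fun j => if h : j ∈ S then a ⟨j, h⟩ else 0)
    (Finset.mem_map_of_mem _ hi)
  simpa using h

include hs in
theorem isStandardRieszBasis_perturbation (hD : 0 < D)
    (hb : ∀ x : L2 A, ∑' j, ⟪f j, x⟫_A * ⟪x, f j⟫_A ≤ D • ⟪x, x⟫_A) {t : ℝ} (ht0 : 0 ≤ t)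
    (ht : t * √D = 1 / 2) : IsStandardRieszBasis A fun j => stdBasis A (σ j) + (t : ℂ) • f j := by
  refine ⟨isStandardFrame_perturbation σ hs hb ?_,
    isGenerating_perturbation σ hs hD hb ht0 ht, fun S a => ⟨fun h j => ?_, fun h => ?_⟩⟩
  · rw [← Real.sq_sqrt hD.le, ← mul_pow, ht]
    norm_num
  · rw [eq_zero_of_hasSum_perturbation σ hs hD hb ht0 ht h j, zero_smul]
  · simp_rw [h]
    exact hasSum_zero

end Perturbation

/-- Tested on the `n`-th standard vector, the lower bound keeps `∑ j, star (f j n) * f j n` at norm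
at least `C`. For finite `J` this sum tends to `0`, since the coordinates of each `f j` do. -/
theorem infinite_of_isStandardFrame [Nontrivial A] {f : J → L2 A} (hf : IsStandardFrame A f) :
    Infinite J := by
  by_contra hJ
  rw [not_infinite_iff_finite] at hJ
  have := Fintype.ofFinite J
  obtain ⟨-, C, D, hC, -, hCD⟩ := hf
  have hbound (n : ℕ) : C ≤ ‖∑ j, star (f j n) * f j n‖ := by
    have h := (hCD (stdBasis A n)).1
    simp_rw [tsum_fintype, inner_stdBasis_left, inner_stdBasis_right, stdBasis_apply,
      if_true] at h
    have h' := CStarAlgebra.norm_le_norm_of_nonneg_of_le (smul_nonneg hC.le zero_le_one) h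
    rwa [norm_smul, CStarRing.norm_one, mul_one, Real.norm_of_nonneg hC.le] at h'
  have hcoord (j : J) : Tendsto (fun n => f j n) atTop (𝓝 0) := by
    rw [tendsto_zero_iff_norm_tendsto_zero]
    have h := (f j).summable_self.tendsto_atTop_zero.norm.sqrt
    simpa [CStarRing.norm_self_mul_star] using h
  have hlim : Tendsto (fun n => ‖∑ j, star (f j n) * f j n‖) atTop (𝓝 0) := by
    simpa using (tendsto_finsetSum Finset.univ fun j _ => (hcoord j).star.mul (hcoord j)).norm
  exact hC.not_ge (ge_of_tendsto' hlim hbound)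

end L2

theorem mainTheorem5 {A : Type*} [CStarAlgebra A] [PartialOrder A] [StarOrderedRing A]
    {J : Type*} [Countable J] (f : J → L2 A) (hf : IsStandardFrame A f) :
    ∃ (c : ℂ) (e r : J → L2 A), IsOrthonormalBasis A e ∧ IsStandardRieszBasis A r ∧
      ∀ j, f j = c • (e j + r j) := by
  rcases subsingleton_or_nontrivial A with hA | hA
  -- Over the zero algebra `J` may be finite, but `ℓ₂(A)` is zero and any family serves.
  · have hL : Subsingleton (L2 A) := ⟨fun x y => L2.ext fun n => Subsingleton.elim _ _⟩
    have hgen : IsGenerating A f := fun x => by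
      rw [Subsingleton.elim x 0]
      exact subset_closure (Submodule.zero_mem _)
    refine ⟨0, f, f, ⟨fun _ => Subsingleton.elim _ _, fun _ _ _ => Subsingleton.elim _ _, hgen⟩,
      ⟨hf, hgen, fun S a => ⟨fun _ _ => Subsingleton.elim _ _, fun h => ?_⟩⟩,
      fun _ => Subsingleton.elim _ _⟩
    simp_rw [h]
    exact hasSum_zero
  · have := L2.infinite_of_isStandardFrame hf
    obtain ⟨σ⟩ : Nonempty (J ≃ ℕ) := nonempty_equiv_of_countable
    obtain ⟨hs, C, D, -, hD, hCD⟩ := hf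
    have hD' : 0 < √D := Real.sqrt_pos.2 hD
    have hne : ((2 * √D : ℝ) : ℂ) ≠ 0 := by exact_mod_cast (by positivity : 2 * √D ≠ 0)
    refine ⟨(2 * √D : ℝ), fun j => -L2.stdBasis A (σ j),
      fun j => L2.stdBasis A (σ j) + (((2 * √D)⁻¹ : ℝ) : ℂ) • f j,
      L2.isOrthonormalBasis_neg_stdBasis σ,
      L2.isStandardRieszBasis_perturbation σ hs hD (fun x => (hCD x).2) (by positivity)
        (by field_simp), fun j => ?_⟩
    rw [neg_add_cancel_left, smul_smul, Complex.ofReal_inv, mul_inv_cancel₀ hne, one_smul]
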